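/- For $\rho\ge 0$ let $\mathrm{Poi}(\rho)$ denote the Poisson law with mean $\rho$ (the Dirac mass at $0$ if $\rho=0$). A \emph{nonlinear process} is a sequence $(\eta(t))_{t\in\mathbb{Z}_+}$ of $\mathbb{Z}_+$-valued random variables on a probability space, with arbitrary initial state $\eta(0)$, such that for every $t\ge 0$ $$\eta(t+1)=\eta(t)-\mathbf 1(\eta(t)>0)+N_{t+1},$$ where $N_{t+1}\sim\mathrm{Poi}(\rho(t))$ with $\rho(t):=\mathbb{P}(\eta(t)>0)$, and $N_{t+1}$ is independent of $(\eta(0),\dots,\eta(t))$. The \emph{M/D/1 queue with arrival rate $\rho\ge 0$} is the Markov chain on $\mathbb{Z}_+$ that moves from $n$ to $n-\mathbf 1(n>0)+M$, where $M\sim\mathrm{Poi}(\rho)$ is drawn afresh at each step. \textbf{Theorem (long-time behaviour of the nonlinear process).} Let $(\eta(t))_{t\in\mathbb{Z}_+}$ be a nonlinear process with $\mathbb{E}(\eta(0))=r\in[0,1)$ and $\mathbb{E}(e^{\lambda\eta(0)})<\infty$ for some $\lambda>0$, and put $\rho_r:=1+r-\sqrt{1+r^2}$. Then the M/D/1 queue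 with arrival rate $\rho_r$ has exactly one invariant probability measure $\pi_{\rho_r}$, and $\eta(t)$ converges in distribution to $\pi_{\rho_r}$ as $t\to\infty$. -/

import Mathlib

open MeasureTheory ProbabilityTheory Filter Topology
open scoped NNReal

/-- `η` is a nonlinear process on the probability space `(Ω, P)`, driven by the variables
`N 1, N 2, …`: given the history `η 0, …, η t`, the variable `N (t + 1)` is independent of it and
Poisson with mean `ρ(t) = P(η t > 0)`, and `η (t + 1) = η t - 1(η t > 0) + N (t + 1)`.
The subtraction in `ℕ` never truncates, and `N 0` plays no role. The history determines, and is
determined by, `η 0, N 1, …, N t`. -/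
structure IsNonlinearProcess {Ω : Type*} [MeasurableSpace Ω] (P : Measure Ω)
    (η N : ℕ → Ω → ℕ) : Prop where
  measurable_init : Measurable (η 0)
  measurable_noise : ∀ t, Measurable (N (t + 1))
  law_noise : ∀ t, P.map (N (t + 1)) = poissonMeasure (P {ω | 0 < η t ω}).toNNReal
  indep : ∀ t, IndepFun (fun ω (s : Fin (t + 1)) => η s ω) (N (t + 1)) P
  step : ∀ t ω, η (t + 1) ω = η t ω - (if 0 < η t ω then 1 else 0) + N (t + 1) ω

/-- Transition kernel of the M/D/1 queue with arrival rate `ρ`: from the state `n` the chain moves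
to `n - 1(n > 0) + M`, where `M` is Poisson with mean `ρ`. -/
noncomputable def md1Kernel (ρ : ℝ≥0) : Kernel ℕ ℕ :=
  Kernel.ofFunOfCountable fun n =>
    (poissonMeasure ρ).map (fun m => n - (if 0 < n then 1 else 0) + m)

/-- `π` is the invariant law of the M/D/1 queue with arrival rate `ρ`: it is an invariant
probability measure of the chain, and the only one. -/
def IsMD1InvariantLaw (ρ : ℝ≥0) (π : ProbabilityMeasure ℕ) : Prop :=
  (md1Kernel ρ).Invariant (π : Measure ℕ) ∧
    ∀ π' : ProbabilityMeasure ℕ, (md1Kernel ρ).Invariant (π' : Measure ℕ) → π' = π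

/-- The arrival rate `ρ_r = 1 + r - √(1 + r²)`. -/
noncomputable def arrivalRate (r : ℝ≥0) : ℝ≥0 :=
  ⟨1 + r - √(1 + (r : ℝ) ^ 2), sub_nonneg.2 (Real.sqrt_le_iff.2
    ⟨by positivity, by nlinarith [r.coe_nonneg]⟩)⟩

/-! The law of `η t` is encoded by its tail function, which evolves by the deterministic map
`tailStep`. This map preserves the mean: a step removes `P(η > 0)` customers on average and adds as
many. For means below 1 it strictly decreases the `ℓ¹` distance of tails (`tsum_abs_tailStep_sub`).
An exponential moment keeps every tail below one geometric sequence (`tailStep_le_geometric`), so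
the orbit is relatively compact. A LaSalle argument then gives convergence
(`exists_tailStep_limit`): the distance between successive states is a strict Lyapunov function, so
a limit point is fixed, and the nonincreasing distance to it tends to 0. The second moment balance
of a fixed point gives its value at 0, the arrival rate (`apply_zero_of_tailStep_eq`). With the rate
frozen at that value, the fixed point is an invariant law of the M/D/1 queue; it is the only one
because the balance equations are triangular (`md1Kernel_invariant_unique`). -/

/-! ### Cauchy products and Poisson tails. -/

/-- Mass at `n` of the Poisson law with mean `a`. -/
noncomputable def poissonMass (a : ℝ) (n : ℕ) : ℝ := Real.exp (-a) * a ^ n / n.factorial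

/-- Cauchy product of two real sequences. -/
def cauchyProd (f g : ℕ → ℝ) (k : ℕ) : ℝ := ∑ ij ∈ Finset.HasAntidiagonal.antidiagonal k, f ij.1 * g ij.2

/-- Probability that a Poisson variable with mean `a` exceeds `k`. -/
noncomputable def poissonTail (a : ℝ) (k : ℕ) : ℝ := 1 - cauchyProd (poissonMass a) (fun _ => 1) k

lemma cauchyProd_eq_coeff (f g : ℕ → ℝ) (k : ℕ) :
    cauchyProd f g k = PowerSeries.coeff k (PowerSeries.mk f * PowerSeries.mk g) := by
  simp [cauchyProd, PowerSeries.coeff_mul]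

lemma mk_cauchyProd (f g : ℕ → ℝ) :
    PowerSeries.mk (cauchyProd f g) = PowerSeries.mk f * PowerSeries.mk g := by
  ext k
  rw [PowerSeries.coeff_mk, cauchyProd_eq_coeff]

lemma cauchyProd_assoc (f g h : ℕ → ℝ) :
    cauchyProd (cauchyProd f g) h = cauchyProd f (cauchyProd g h) := by
  funext k
  simp only [cauchyProd_eq_coeff, mk_cauchyProd, mul_assoc]

lemma cauchyProd_add (f g h : ℕ → ℝ) (k : ℕ) :
    cauchyProd f (fun n => g n + h n) k = cauchyProd f g k + cauchyProd f h k := by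
  simp [cauchyProd, mul_add, Finset.sum_add_distrib]

lemma cauchyProd_sub (f g h : ℕ → ℝ) (k : ℕ) :
    cauchyProd f (fun n => g n - h n) k = cauchyProd f g k - cauchyProd f h k := by
  simp [cauchyProd, mul_sub, Finset.sum_sub_distrib]

lemma cauchyProd_one (f : ℕ → ℝ) (k : ℕ) :
    cauchyProd f (fun _ => 1) k = ∑ i ∈ Finset.range (k + 1), f i := by
  simp [cauchyProd, Finset.Nat.sum_antidiagonal_eq_sum_range_succ_mk]

lemma hasSum_cauchyProd {f g : ℕ → ℝ} {s t : ℝ} (hf : HasSum f s) (hg : HasSum g t) :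
    HasSum (cauchyProd f g) (s * t) := by
  have h1 : Summable fun n => ‖f n‖ := hf.summable.abs
  have h2 : Summable fun n => ‖g n‖ := hg.summable.abs
  have h := tsum_mul_tsum_eq_tsum_sum_antidiagonal_of_summable_norm h1 h2
  rw [hf.tsum_eq, hg.tsum_eq] at h
  rw [h]
  exact (summable_norm_sum_mul_antidiagonal_of_summable_norm h1 h2).of_norm.hasSum

lemma hasSum_poissonMass (a : ℝ) : HasSum (poissonMass a) 1 := by
  have h := (NormedSpace.expSeries_div_hasSum_exp a).mul_left (Real.exp (-a))
  rw [← Real.exp_eq_exp_ℝ, ← Real.exp_add, neg_add_cancel, Real.exp_zero] at h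
  exact h.congr_fun fun n => by simp [poissonMass, mul_div_assoc]

lemma poissonMass_nonneg {a : ℝ} (ha : 0 ≤ a) (n : ℕ) : 0 ≤ poissonMass a n := by
  unfold poissonMass; positivity

lemma poissonMass_pos {a : ℝ} (ha : 0 < a) (n : ℕ) : 0 < poissonMass a n := by
  unfold poissonMass; positivity

lemma poissonMass_zero_pos (a : ℝ) : 0 < poissonMass a 0 := by
  simp [poissonMass, Real.exp_pos]

lemma succ_mul_poissonMass_succ (a : ℝ) (n : ℕ) :
    ((n : ℝ) + 1) * poissonMass a (n + 1) = a * poissonMass a n := by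
  have : (n.factorial : ℝ) ≠ 0 := by positivity
  have : ((n : ℝ) + 1) ≠ 0 := by positivity
  simp only [poissonMass, Nat.factorial_succ, pow_succ]
  push_cast
  field_simp

lemma cauchyProd_poissonMass (a b : ℝ) :
    cauchyProd (poissonMass a) (poissonMass b) = poissonMass (a + b) := by
  funext k
  have hk : (k.factorial : ℝ) ≠ 0 := by positivity
  simp only [cauchyProd, poissonMass, neg_add, Real.exp_add]
  rw [(Commute.all a b).add_pow', Finset.mul_sum, Finset.sum_div]
  refine Finset.sum_congr rfl fun ij hij => ?_
  have h : ((k.choose ij.1 : ℕ) : ℝ) * ij.1.factorial * ij.2.factorial = k.factorial := by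
    rw [← Finset.HasAntidiagonal.mem_antidiagonal.1 hij]
    rw [Nat.choose_symm_add]
    exact_mod_cast Nat.add_choose_mul_factorial_mul_factorial ij.1 ij.2
  have h1 : (ij.1.factorial : ℝ) ≠ 0 := by positivity
  have h2 : (ij.2.factorial : ℝ) ≠ 0 := by positivity
  rw [nsmul_eq_mul, ← h]
  rw [← h] at hk
  have h3 : ((k.choose ij.1 : ℕ) : ℝ) ≠ 0 := fun h0 => hk (by rw [h0]; ring)
  field_simp

/-- Split the variable into independent Poisson parts: either the `b` part alone exceeds `k`, or it
equals some `i ≤ k` and the `a` part exceeds `k - i`. -/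
lemma poissonTail_add (a b : ℝ) (k : ℕ) :
    poissonTail (a + b) k = cauchyProd (poissonMass b) (poissonTail a) k + poissonTail b k := by
  have h : poissonTail a = fun n => 1 - cauchyProd (poissonMass a) (fun _ => 1) n := rfl
  rw [h, cauchyProd_sub (poissonMass b) (fun _ => 1), ← cauchyProd_assoc, cauchyProd_poissonMass,
    poissonTail, poissonTail, add_comm b a]
  ring

lemma hasSum_poissonMass_add (a : ℝ) (k : ℕ) :
    HasSum (fun n => poissonMass a (n + (k + 1))) (poissonTail a k) := by
  rw [poissonTail, cauchyProd_one]
  exact (hasSum_nat_add_iff' (k + 1)).2 (hasSum_poissonMass a)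

lemma poissonTail_nonneg {a : ℝ} (ha : 0 ≤ a) (k : ℕ) : 0 ≤ poissonTail a k :=
  (hasSum_poissonMass_add a k).nonneg fun _ => poissonMass_nonneg ha _

lemma poissonTail_pos {a : ℝ} (ha : 0 < a) (k : ℕ) : 0 < poissonTail a k :=
  (poissonMass_pos ha (0 + (k + 1))).trans_le
    (le_hasSum (hasSum_poissonMass_add a k) 0 fun _ _ => poissonMass_nonneg ha.le _)

/-- A nonnegative double series may be summed along antidiagonals or along rows. -/
lemma hasSum_rows_of_hasSum_antidiagonal {f : ℕ × ℕ → ℝ} (hf : ∀ x, 0 ≤ f x) {g : ℕ → ℝ}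
    (hg : ∀ k, HasSum (fun n => f (k, n)) (g k)) {s : ℝ}
    (hs : HasSum (fun m => ∑ x ∈ Finset.HasAntidiagonal.antidiagonal m, f x) s) : HasSum g s := by
  have h1 : ∀ m, HasSum (fun x : Finset.HasAntidiagonal.antidiagonal m => f x)
      (∑ x ∈ Finset.HasAntidiagonal.antidiagonal m, f x) := fun m => by
    rw [← Finset.sum_coe_sort]; exact hasSum_fintype _
  have h2 : Summable fun x : Σ m : ℕ, Finset.HasAntidiagonal.antidiagonal m => f x.2 := by
    rw [summable_sigma_of_nonneg fun x => hf _]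
    exact ⟨fun m => (h1 m).summable, hs.summable.congr fun m => (h1 m).tsum_eq.symm⟩
  have h3 : HasSum (fun x : Σ m : ℕ, Finset.HasAntidiagonal.antidiagonal m => f x.2) s := by
    have := h2.hasSum.sigma h1
    rw [hs.unique this]
    exact h2.hasSum
  have h4 : HasSum f s := Finset.HasAntidiagonal.sigmaAntidiagonalEquivProd.hasSum_iff.1 h3
  exact h4.prod_fiberwise hg

lemma hasSum_natCast_mul_poissonMass (a : ℝ) :
    HasSum (fun n : ℕ => (n : ℝ) * poissonMass a n) a := by
  rw [← hasSum_nat_add_iff' 1]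
  simpa [succ_mul_poissonMass_succ] using (hasSum_poissonMass a).mul_left a

lemma hasSum_poissonTail {a : ℝ} (ha : 0 ≤ a) : HasSum (poissonTail a) a := by
  refine hasSum_rows_of_hasSum_antidiagonal (f := fun x => poissonMass a (x.2 + (x.1 + 1)))
    (fun _ => poissonMass_nonneg ha _) (hasSum_poissonMass_add a) ?_
  have h := (hasSum_poissonMass a).mul_left a
  rw [mul_one] at h
  refine h.congr_fun fun m => ?_
  rw [← succ_mul_poissonMass_succ,
    Finset.sum_congr rfl (g := fun _ => poissonMass a (m + 1)) fun x hx => by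
      rw [← Finset.HasAntidiagonal.mem_antidiagonal.1 hx]; congr 1; ring]
  simp

/-- Summation along antidiagonals turns the series into `E[X(X - 1)] / 2`, half the second factorial
moment. -/
lemma hasSum_natCast_mul_poissonTail {a : ℝ} (ha : 0 ≤ a) :
    HasSum (fun k : ℕ => (k : ℝ) * poissonTail a k) (a ^ 2 / 2) := by
  refine hasSum_rows_of_hasSum_antidiagonal
    (f := fun x => (x.1 : ℝ) * poissonMass a (x.2 + (x.1 + 1)))
    (fun _ => mul_nonneg (by positivity) (poissonMass_nonneg ha _))
    (fun k => (hasSum_poissonMass_add a k).mul_left _) ?_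
  have h := (hasSum_natCast_mul_poissonMass a).mul_left (a / 2)
  rw [show a / 2 * a = a ^ 2 / 2 by ring] at h
  refine h.congr_fun fun m => ?_
  rw [Finset.sum_congr rfl (g := fun x => (x.1 : ℝ) * poissonMass a (m + 1)) fun x hx => by
      rw [← Finset.HasAntidiagonal.mem_antidiagonal.1 hx]; congr 2; ring, ← Finset.sum_mul]
  have h0 : ∑ x ∈ Finset.HasAntidiagonal.antidiagonal m, (x.1 : ℝ) = m * (m + 1) / 2 := by
    rw [Finset.Nat.sum_antidiagonal_eq_sum_range_succ_mk]
    clear h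
    induction m with
    | zero => simp
    | succ m ih => rw [Finset.sum_range_succ, ih]; push_cast; ring
  rw [h0]
  linear_combination (m / 2 : ℝ) * succ_mul_poissonMass_succ a m

/-! ### The nonlinear step on tail functions. -/

/-- One step of the nonlinear process, read on the tail function `F k = P(η > k)`. -/
noncomputable def tailStep (F : ℕ → ℝ) (k : ℕ) : ℝ :=
  cauchyProd (poissonMass (F 0)) (fun j => F (j + 1)) k + poissonTail (F 0) k

/-- `F` is a nonincreasing nonnegative sequence of sum `r`, that is, the tail function of a law
of mean `r`, provided that `F 0 ≤ 1`. -/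
structure IsTailOfMean (r : ℝ) (F : ℕ → ℝ) : Prop where
  antitone : Antitone F
  nonneg : ∀ k, 0 ≤ F k
  hasSum : HasSum F r

lemma IsTailOfMean.le {r : ℝ} {F : ℕ → ℝ} (hF : IsTailOfMean r F) (k : ℕ) : F k ≤ r :=
  le_hasSum hF.hasSum k fun _ _ => hF.nonneg _

lemma IsTailOfMean.hasSum_shift {r : ℝ} {F : ℕ → ℝ} (hF : IsTailOfMean r F) :
    HasSum (fun j => F (j + 1)) (r - F 0) := by
  simpa using (hasSum_nat_add_iff' 1).2 hF.hasSum

lemma hasSum_tailStep {r : ℝ} {F : ℕ → ℝ} (hF : IsTailOfMean r F) : HasSum (tailStep F) r := by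
  have h := (hasSum_cauchyProd (hasSum_poissonMass (F 0)) hF.hasSum_shift).add
    (hasSum_poissonTail (hF.nonneg 0))
  rwa [one_mul, sub_add_cancel] at h

/-! ### Contraction in `ℓ¹`. -/

lemma abs_cauchyProd_poissonMass_le {a : ℝ} (ha : 0 ≤ a) (h : ℕ → ℝ) (k : ℕ) :
    |cauchyProd (poissonMass a) h k| ≤ cauchyProd (poissonMass a) (fun n => |h n|) k := by
  refine (Finset.abs_sum_le_sum_abs _ _).trans_eq (Finset.sum_congr rfl fun x _ => ?_)
  rw [abs_mul, abs_of_nonneg (poissonMass_nonneg ha _)]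

lemma hasSum_cauchyProd_poissonMass_abs (a : ℝ) {h : ℕ → ℝ} (hh : Summable h) :
    HasSum (cauchyProd (poissonMass a) fun n => |h n|) (∑' k, |h k|) := by
  simpa using hasSum_cauchyProd (hasSum_poissonMass a) hh.abs.hasSum

lemma summable_abs_cauchyProd_poissonMass (a : ℝ) {h : ℕ → ℝ} (hh : Summable h) :
    Summable fun k => |cauchyProd (poissonMass a) h k| :=
  (hasSum_cauchyProd (hasSum_poissonMass a) hh.hasSum).summable.abs

lemma tsum_abs_cauchyProd_poissonMass_le {a : ℝ} (ha : 0 ≤ a) {h : ℕ → ℝ} (hh : Summable h) :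
    ∑' k, |cauchyProd (poissonMass a) h k| ≤ ∑' k, |h k| :=
  hasSum_le (abs_cauchyProd_poissonMass_le ha h)
    (summable_abs_cauchyProd_poissonMass a hh).hasSum (hasSum_cauchyProd_poissonMass_abs a hh)

/-- All Poisson weights are positive, so at index `i + j` the values `h i` and `h j`, of opposite
signs, enter the same sum and partly cancel. -/
lemma tsum_abs_cauchyProd_poissonMass_lt {a : ℝ} (ha : 0 < a) {h : ℕ → ℝ} (hh : Summable h)
    {i j : ℕ} (hi : h i < 0) (hj : 0 < h j) :
    ∑' k, |cauchyProd (poissonMass a) h k| < ∑' k, |h k| := by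
  refine hasSum_lt (i := i + j) (abs_cauchyProd_poissonMass_le ha.le h) ?_
    (summable_abs_cauchyProd_poissonMass a hh).hasSum (hasSum_cauchyProd_poissonMass_abs a hh)
  rw [abs_lt, neg_lt]
  simp only [cauchyProd, ← Finset.sum_neg_distrib]
  constructor
  · refine Finset.sum_lt_sum (fun x _ => ?_) ⟨(i, j), by simp, ?_⟩
    · rw [← mul_neg]
      exact mul_le_mul_of_nonneg_left (neg_le_abs _) (poissonMass_nonneg ha.le _)
    · rw [← mul_neg]
      exact mul_lt_mul_of_pos_left (by rw [abs_of_pos hj]; linarith) (poissonMass_pos ha _)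
  · refine Finset.sum_lt_sum (fun x _ => ?_) ⟨(j, i), by simp [add_comm], ?_⟩
    · exact mul_le_mul_of_nonneg_left (le_abs_self _) (poissonMass_nonneg ha.le _)
    · exact mul_lt_mul_of_pos_left (by rw [abs_of_neg hi]; linarith) (poissonMass_pos ha _)

/-- The increase of the tail function when an independent Poisson variable is added. -/
lemma poisson_increment_ge {F : ℕ → ℝ} (hF : Antitone F) {a : ℝ} (ha : 0 ≤ a) (k : ℕ) :
    poissonTail a k * (1 - F k) ≤
      cauchyProd (poissonMass a) F k + poissonTail a k - F k := by
  have h1 : cauchyProd (poissonMass a) (fun _ => 1) k * F k ≤ cauchyProd (poissonMass a) F k := by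
    rw [cauchyProd, cauchyProd, Finset.sum_mul]
    refine Finset.sum_le_sum fun x hx => ?_
    rw [mul_one]
    refine mul_le_mul_of_nonneg_left (hF ?_) (poissonMass_nonneg ha _)
    rw [← Finset.HasAntidiagonal.mem_antidiagonal.1 hx]; omega
  have h2 : poissonTail a k = 1 - cauchyProd (poissonMass a) (fun _ => 1) k := rfl
  have : (1 - poissonTail a k) * F k ≤ cauchyProd (poissonMass a) F k := by rw [h2]; linarith
  linarith

/-- Split the larger noise as `Poi(G 0)` plus an extra `Poi(δ)`. The difference of the images is
then `D + E` smoothed by `Poi(G 0)`: `D` compares the shifted tails, and `E ≥ 0` is the effect of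
the extra noise. The shift removes `δ` from the `ℓ¹` distance and `E` restores exactly `δ`. -/
lemma tsum_abs_tailStep_sub_of_le {r : ℝ} (hr : r < 1) {F G : ℕ → ℝ} (hF : IsTailOfMean r F)
    (hG : IsTailOfMean r G) (h0 : G 0 ≤ F 0) :
    (∑' k, |tailStep F k - tailStep G k| ≤ ∑' k, |F k - G k|) ∧
      (F ≠ G → ∑' k, |tailStep F k - tailStep G k| < ∑' k, |F k - G k|) := by
  obtain ⟨δ, hδ⟩ : ∃ δ, δ = F 0 - G 0 := ⟨_, rfl⟩
  have hδ0 : 0 ≤ δ := by linarith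
  have hF0 : F 0 = δ + G 0 := by linarith
  obtain ⟨E, hE⟩ : ∃ E : ℕ → ℝ, E = fun k => cauchyProd (poissonMass δ) (fun j => F (j + 1)) k
    + poissonTail δ k - F (k + 1) := ⟨_, rfl⟩
  obtain ⟨D, hD⟩ : ∃ D : ℕ → ℝ, D = fun k => F (k + 1) - G (k + 1) := ⟨_, rfl⟩
  have hS : Antitone fun j => F (j + 1) := fun i j hij => hF.antitone (by omega)
  have hEge : ∀ k, poissonTail δ k * (1 - F (k + 1)) ≤ E k := fun k => by
    rw [hE]; exact poisson_increment_ge hS hδ0 k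
  have hF1 : ∀ k, 0 < 1 - F (k + 1) := fun k => by linarith [hF.le (k + 1)]
  have hE0 : ∀ k, 0 ≤ E k := fun k =>
    (mul_nonneg (poissonTail_nonneg hδ0 k) (hF1 k).le).trans (hEge k)
  have hEs : HasSum E δ := by
    have h := ((hasSum_cauchyProd (hasSum_poissonMass δ) hF.hasSum_shift).add
      (hasSum_poissonTail hδ0)).sub hF.hasSum_shift
    rw [one_mul, add_sub_cancel_left] at h
    rwa [hE]
  have hDs : HasSum D (-δ) := by
    have h := hF.hasSum_shift.sub hG.hasSum_shift
    rw [show r - F 0 - (r - G 0) = -δ by rw [hδ]; ring] at h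
    rwa [hD]
  have hdec : ∀ k, tailStep F k - tailStep G k =
      cauchyProd (poissonMass (G 0)) (fun k => D k + E k) k := fun k => by
    have hDE : (fun k => D k + E k) = fun k => (cauchyProd (poissonMass δ) (fun j => F (j + 1)) k
        + poissonTail δ k) - G (k + 1) := by
      rw [hD, hE]; funext k; ring
    rw [hDE, cauchyProd_sub, cauchyProd_add, tailStep, tailStep, hF0, poissonTail_add,
      ← cauchyProd_assoc, cauchyProd_poissonMass, add_comm (G 0) δ]
    ring
  simp_rw [hdec]
  have hFG : HasSum (fun k => |D k| + E k) (∑' k, |F k - G k|) := by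
    have h := (hF.hasSum.sub hG.hasSum).summable.abs.hasSum
    have h1 := ((hasSum_nat_add_iff' 1).2 h).add hEs
    rw [Finset.sum_range_one, abs_of_nonneg (by linarith), ← hδ, sub_add_cancel] at h1
    rwa [hD]
  have hHs := hDs.summable.add hEs.summable
  have hle : ∀ k, |D k + E k| ≤ |D k| + E k := fun k =>
    (abs_add_le _ _).trans_eq (by rw [abs_of_nonneg (hE0 k)])
  have hC := tsum_abs_cauchyProd_poissonMass_le (hG.nonneg 0) hHs
  refine ⟨hC.trans (hasSum_le hle hHs.abs.hasSum hFG), fun hne => ?_⟩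
  -- If `δ > 0`, then `D` has negative sum while `E` is positive everywhere (here `r < 1` matters),
  -- so `D + E` itself has a cancellation. If `δ = 0`, then `E = 0` and `D` takes both signs, so the
  -- loss comes from the Poisson smoothing.
  obtain hpos | hzero := hδ0.lt_or_eq
  · obtain ⟨k, hk⟩ : ∃ k, D k < 0 := by
      by_contra! h
      linarith [hDs.nonneg h]
    refine hC.trans_lt (hasSum_lt hle (i := k) ?_ hHs.abs.hasSum hFG)
    have hEk : 0 < E k := (mul_pos (poissonTail_pos hpos k) (hF1 k)).trans_le (hEge k)
    rw [abs_of_neg hk, abs_lt]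
    constructor <;> linarith
  · have hEz : E = 0 := (hasSum_zero_iff_of_nonneg hE0).1 (hzero ▸ hEs)
    simp only [hEz, Pi.zero_apply, add_zero] at hHs hFG ⊢
    rw [← hzero, neg_zero] at hDs
    have hDne : D ≠ 0 := fun h => hne <| funext fun k => by
      obtain _ | k := k
      · linarith
      · have := congrFun h k
        rw [hD] at this
        exact sub_eq_zero.1 this
    obtain ⟨i, hi⟩ : ∃ i, D i < 0 := by
      by_contra! h
      exact hDne ((hasSum_zero_iff_of_nonneg h).1 hDs)
    obtain ⟨j, hj⟩ : ∃ j, 0 < D j := by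
      by_contra! h
      have h' := (hasSum_zero_iff_of_nonneg fun k => neg_nonneg.2 (h k)).1 (by simpa using hDs.neg)
      exact hDne (funext fun k => by simpa using congrFun h' k)
    have hG0 : 0 < G 0 := by
      refine (hG.nonneg 0).lt_of_ne fun h => ?_
      rw [hD] at hj
      have h1 := hF.antitone (Nat.zero_le (j + 1))
      have h2 := hG.nonneg (j + 1)
      simp only at hj
      linarith
    rw [← hFG.tsum_eq]
    exact tsum_abs_cauchyProd_poissonMass_lt hG0 hHs hi hj

/-- On the laws of a given mean `r < 1`, the nonlinear step is strictly contracting for the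
Wasserstein distance of order one. -/
lemma tsum_abs_tailStep_sub {r : ℝ} (hr : r < 1) {F G : ℕ → ℝ} (hF : IsTailOfMean r F)
    (hG : IsTailOfMean r G) :
    (∑' k, |tailStep F k - tailStep G k| ≤ ∑' k, |F k - G k|) ∧
      (F ≠ G → ∑' k, |tailStep F k - tailStep G k| < ∑' k, |F k - G k|) := by
  obtain h | h := le_total (G 0) (F 0)
  · exact tsum_abs_tailStep_sub_of_le hr hF hG h
  · have h' := tsum_abs_tailStep_sub_of_le hr hG hF h
    simpa only [abs_sub_comm, ne_comm] using h'

lemma continuous_tailStep : Continuous tailStep := by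
  refine continuous_pi fun k => ?_
  unfold tailStep poissonTail cauchyProd poissonMass
  fun_prop

/-! ### Geometric bounds on tails. -/

lemma hasSum_poissonMass_mul_pow (a s : ℝ) :
    HasSum (fun n => poissonMass a n * s ^ n) (Real.exp (a * (s - 1))) := by
  have h := (hasSum_poissonMass (a * s)).mul_left (Real.exp (a * (s - 1)))
  rw [mul_one] at h
  refine h.congr_fun fun n => ?_
  rw [poissonMass, poissonMass, ← mul_div_assoc, ← mul_assoc, ← Real.exp_add,
    show a * (s - 1) + -(a * s) = -a by ring]
  ring

/-- A Chernoff bound: the departure gains a factor `s⁻¹`, and the arrivals cost at most their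
generating function at `s`. `1 ≤ C` lets the same bound absorb the pure noise term. -/
lemma tailStep_le_geometric {C s : ℝ} (hC : 1 ≤ C) (hs : 1 ≤ s) {F : ℕ → ℝ} (hF0 : 0 ≤ F 0)
    (hF : ∀ k, F k ≤ C * s⁻¹ ^ k) (hexp : Real.exp (F 0 * (s - 1)) ≤ s) (k : ℕ) :
    tailStep F k ≤ C * s⁻¹ ^ k := by
  have hs0 : 0 < s := by linarith
  have hp := poissonMass_nonneg hF0
  have hsum := hasSum_poissonMass_mul_pow (F 0) s
  have h1 : cauchyProd (poissonMass (F 0)) (fun j => F (j + 1)) k ≤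
      C * s⁻¹ ^ (k + 1) * ∑ i ∈ Finset.range (k + 1), poissonMass (F 0) i * s ^ i := by
    rw [← cauchyProd_one, cauchyProd, cauchyProd, Finset.mul_sum]
    refine Finset.sum_le_sum fun x hx => ?_
    rw [← Finset.HasAntidiagonal.mem_antidiagonal.1 hx]
    refine (mul_le_mul_of_nonneg_left (hF _) (hp _)).trans_eq ?_
    rw [show x.1 + x.2 + 1 = x.1 + (x.2 + 1) by ring, pow_add s⁻¹ x.1, inv_pow s x.1]
    field_simp
  have h2 : poissonTail (F 0) k ≤ C * s⁻¹ ^ (k + 1) *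
      (Real.exp (F 0 * (s - 1)) - ∑ i ∈ Finset.range (k + 1), poissonMass (F 0) i * s ^ i) := by
    refine hasSum_le (fun n => ?_) (hasSum_poissonMass_add (F 0) k)
      (((hasSum_nat_add_iff' (k + 1)).2 hsum).mul_left _)
    have : 1 ≤ s⁻¹ ^ (k + 1) * s ^ (n + (k + 1)) := by
      rw [pow_add s, mul_comm, mul_assoc, ← mul_pow, mul_inv_cancel₀ hs0.ne', one_pow, mul_one]
      exact one_le_pow₀ hs
    calc poissonMass (F 0) (n + (k + 1)) = poissonMass (F 0) (n + (k + 1)) * (1 * 1) := by ring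
      _ ≤ poissonMass (F 0) (n + (k + 1)) * (C * (s⁻¹ ^ (k + 1) * s ^ (n + (k + 1)))) := by
        gcongr
        exact hp _
      _ = _ := by ring
  calc tailStep F k ≤ C * s⁻¹ ^ (k + 1) * Real.exp (F 0 * (s - 1)) := by
        rw [tailStep]; linarith
    _ ≤ C * s⁻¹ ^ (k + 1) * s := by gcongr
    _ = C * s⁻¹ ^ k := by rw [pow_succ]; field_simp

/-! ### Fixed points and convergence of orbits. -/

/-- The fixed points of the nonlinear step of mean `r < 1` have intensity `1 + r - √(1 + r²)`. -/
lemma apply_zero_of_tailStep_eq {r : ℝ} {x : ℕ → ℝ} (hx : IsTailOfMean r x)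
    (hs : Summable fun k : ℕ => (k : ℝ) * x k) (hfix : tailStep x = x) :
    x 0 = 1 + r - √(1 + r ^ 2) := by
  obtain ⟨M, hM⟩ := hs
  obtain ⟨ρ, hρ⟩ : ∃ ρ, ρ = x 0 := ⟨_, rfl⟩
  have hρ0 : 0 ≤ ρ := hρ ▸ hx.nonneg 0
  have hρr : ρ ≤ r := hρ ▸ hx.le 0
  have hshift := hx.hasSum_shift
  rw [← hρ] at hshift
  have hM' : HasSum (fun j : ℕ => (j : ℝ) * x (j + 1)) (M - (r - ρ)) := by
    have h := ((hasSum_nat_add_iff' 1).2 hM).sub hshift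
    simp only [Finset.sum_range_one, Nat.cast_zero, zero_mul, sub_zero] at h
    exact h.congr_fun fun j => by push_cast; ring
  have h1 := (hasSum_cauchyProd (hasSum_natCast_mul_poissonMass ρ) hshift).add
    (hasSum_cauchyProd (hasSum_poissonMass ρ) hM')
  have h2 : HasSum (fun k : ℕ => (k : ℝ) * x k)
      (ρ * (r - ρ) + 1 * (M - (r - ρ)) + ρ ^ 2 / 2) := by
    refine (h1.add (hasSum_natCast_mul_poissonTail hρ0)).congr_fun fun k => ?_
    rw [← congrFun hfix k, tailStep, ← hρ, mul_add]
    congr 1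
    rw [cauchyProd, cauchyProd, cauchyProd, Finset.mul_sum, ← Finset.sum_add_distrib]
    refine Finset.sum_congr rfl fun y hy => ?_
    rw [← Finset.HasAntidiagonal.mem_antidiagonal.1 hy]
    push_cast
    ring
  -- `M` cancels, leaving a quadratic equation for `ρ`; `ρ ≤ r` selects the smaller root.
  have h3 := hM.unique h2
  rw [← hρ]
  have h4 : √(1 + r ^ 2) = 1 + r - ρ := by
    rw [show 1 + r ^ 2 = (1 + r - ρ) ^ 2 by linear_combination (-2) * h3,
      Real.sqrt_sq (by linarith)]
  linarith

/-- Convergence of the orbits of the nonlinear step with geometrically decaying tails. -/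
theorem exists_tailStep_limit {r C q : ℝ} (hr : r < 1) (hq0 : 0 ≤ q) (hq1 : q < 1)
    {F : ℕ → ℕ → ℝ} (hF : ∀ t, IsTailOfMean r (F t)) (hbound : ∀ t k, F t k ≤ C * q ^ k)
    (hstep : ∀ t, F (t + 1) = tailStep (F t)) :
    ∃ x, IsTailOfMean r x ∧ (∀ k, x k ≤ C * q ^ k) ∧ tailStep x = x ∧
      Tendsto F atTop (𝓝 x) := by
  have hgeo : Summable fun k => C * q ^ k := (summable_geometric_of_lt_one hq0 hq1).mul_left C
  -- The common geometric majorant upgrades pointwise convergence to convergence of sums, so no mean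
  -- escapes in the limit.
  have hlim : ∀ {u : ℕ → ℕ → ℝ} {y : ℕ → ℝ}, (∀ n, IsTailOfMean r (u n)) →
      (∀ n k, u n k ≤ C * q ^ k) → Tendsto u atTop (𝓝 y) →
      IsTailOfMean r y ∧ ∀ k, y k ≤ C * q ^ k := fun {u y} hu hb h => by
    rw [tendsto_pi_nhds] at h
    have hy0 : ∀ k, 0 ≤ y k := fun k => ge_of_tendsto' (h k) fun n => (hu n).nonneg k
    have hyb : ∀ k, y k ≤ C * q ^ k := fun k => le_of_tendsto' (h k) fun n => hb n k
    refine ⟨⟨fun i j hij => le_of_tendsto_of_tendsto' (h j) (h i) fun n => (hu n).antitone hij,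
      hy0, ?_⟩, hyb⟩
    have h1 := tendsto_tsum_of_dominated_convergence hgeo h (.of_forall fun n k => by
      rw [Real.norm_of_nonneg ((hu n).nonneg k)]; exact hb n k)
    simp_rw [fun n => (hu n).hasSum.tsum_eq] at h1
    rw [tendsto_nhds_unique tendsto_const_nhds h1]
    exact (Summable.of_nonneg_of_le hy0 hyb hgeo).hasSum
  have hdist : ∀ {u v : ℕ → ℕ → ℝ} {y z : ℕ → ℝ}, (∀ n, IsTailOfMean r (u n)) →
      (∀ n, IsTailOfMean r (v n)) → (∀ n k, u n k ≤ C * q ^ k) → (∀ n k, v n k ≤ C * q ^ k) →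
      Tendsto u atTop (𝓝 y) → Tendsto v atTop (𝓝 z) →
      Tendsto (fun n => ∑' k, |u n k - v n k|) atTop (𝓝 (∑' k, |y k - z k|)) :=
    fun {u v y z} hu hv hub hvb hy hz => by
      rw [tendsto_pi_nhds] at hy hz
      refine tendsto_tsum_of_dominated_convergence hgeo (fun k => ((hy k).sub (hz k)).abs)
        (.of_forall fun n k => ?_)
      rw [Real.norm_eq_abs, abs_abs, abs_le]
      constructor <;> linarith [(hu n).nonneg k, (hv n).nonneg k, hub n k, hvb n k]
  obtain ⟨x, -, φ, hφ, hx⟩ := (isCompact_univ_pi fun k : ℕ =>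
    isCompact_Icc (a := (0 : ℝ)) (b := C * q ^ k)).isSeqCompact
    (x := F) fun t k _ => ⟨(hF t).nonneg k, hbound t k⟩
  have hx' : Tendsto (fun n => F (φ n)) atTop (𝓝 x) := hx
  have hnext : ∀ {u : ℕ → ℕ} {y : ℕ → ℝ}, Tendsto (fun n => F (u n)) atTop (𝓝 y) →
      Tendsto (fun n => F (u n + 1)) atTop (𝓝 (tailStep y)) := fun {u y} h => by
    simp_rw [hstep]
    exact (continuous_tailStep.tendsto y).comp h
  have hx1 := hnext hx'
  have hx2 := hnext hx1
  obtain ⟨hxT, hxb⟩ := hlim (fun n => hF _) (fun n => hbound _) hx'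
  obtain ⟨hxT1, -⟩ := hlim (fun n => hF _) (fun n => hbound _) hx1
  have hanti : Antitone fun t => ∑' k, |F t k - F (t + 1) k| := antitone_nat_of_succ_le fun t => by
    have h := (tsum_abs_tailStep_sub hr (hF t) (hF (t + 1))).1
    rwa [← hstep, ← hstep] at h
  obtain ⟨c, hc⟩ : ∃ c, Tendsto (fun t => ∑' k, |F t k - F (t + 1) k|) atTop (𝓝 c) :=
    ⟨_, tendsto_atTop_ciInf hanti ⟨0, by rintro _ ⟨t, rfl⟩; positivity⟩⟩
  -- Along the subsequence, `d(x, Tx)` and `d(Tx, T²x)` are both the limit `c`, which strict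
  -- contraction forbids unless `Tx = x`.
  have hfix : tailStep x = x := by
    by_contra hne
    have h0 := hdist (fun n => hF _) (fun n => hF _) (fun n => hbound _) (fun n => hbound _) hx' hx1
    have h1 := hdist (fun n => hF _) (fun n => hF _) (fun n => hbound _) (fun n => hbound _) hx1 hx2
    have e0 := tendsto_nhds_unique h0 (hc.comp hφ.tendsto_atTop)
    have e1 := tendsto_nhds_unique h1
      (hc.comp ((tendsto_add_atTop_nat 1).comp hφ.tendsto_atTop))
    have := (tsum_abs_tailStep_sub hr hxT hxT1).2 (Ne.symm hne)
    rw [e0, e1] at this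
    exact this.false
  refine ⟨x, hxT, hxb, hfix, ?_⟩
  have hanti' : Antitone fun t => ∑' k, |F t k - x k| := antitone_nat_of_succ_le fun t => by
    have h := (tsum_abs_tailStep_sub hr (hF t) hxT).1
    rwa [← hstep, hfix] at h
  have hd : Tendsto (fun t => ∑' k, |F t k - x k|) atTop (𝓝 0) := by
    have h1 := hdist (fun n => hF _) (fun _ => hxT) (fun n => hbound _) (fun _ => hxb) hx'
      tendsto_const_nhds
    simp only [sub_self, abs_zero, tsum_zero] at h1
    have h2 := tendsto_atTop_ciInf hanti' ⟨0, by rintro _ ⟨t, rfl⟩; positivity⟩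
    rwa [tendsto_nhds_unique h1 (h2.comp hφ.tendsto_atTop)]
  rw [tendsto_pi_nhds]
  intro k
  rw [tendsto_iff_dist_tendsto_zero]
  refine squeeze_zero (fun _ => dist_nonneg) (fun t => ?_) hd
  exact ((hF t).hasSum.sub hxT.hasSum).summable.abs.le_tsum k fun _ _ => abs_nonneg _

/-! ### Laws on `ℕ` and their tail functions. -/

/-- Tail function of a measure on `ℕ`. -/
noncomputable def measureTail (μ : Measure ℕ) (k : ℕ) : ℝ := μ.real (Set.Ioi k)

/-- Departure of one customer and arrival of `x.2` customers in a queue of length `x.1`. -/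
def queueStep (x : ℕ × ℕ) : ℕ := x.1 - (if 0 < x.1 then 1 else 0) + x.2

lemma measureReal_Iic (μ : Measure ℕ) [IsProbabilityMeasure μ] (k : ℕ) :
    μ.real (Set.Iic k) = 1 - measureTail μ k := by
  rw [measureTail, ← Set.compl_Iic, probReal_compl_eq_one_sub measurableSet_Iic]
  ring

/-- With `i` arrivals and `i + j = k`, the new length is at most `k` exactly when the old one is at
most `j + 1`; the empty queue fits the same condition. -/
lemma queueStep_preimage_Iic (k : ℕ) :
    queueStep ⁻¹' Set.Iic k =
      ⋃ ij ∈ Finset.HasAntidiagonal.antidiagonal k, Set.Iic (ij.2 + 1) ×ˢ {ij.1} := by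
  ext ⟨n, m⟩
  simp only [Set.mem_preimage, queueStep, Set.mem_Iic, Set.mem_iUnion, Set.mem_prod,
    Set.mem_singleton_iff, Finset.HasAntidiagonal.mem_antidiagonal, exists_prop, Prod.exists]
  constructor
  · intro h
    refine ⟨m, k - m, ?_, ?_, rfl⟩ <;> split_ifs at h <;> omega
  · rintro ⟨i, j, h1, h2, h3⟩
    split_ifs <;> omega

lemma map_queueStep_real_Iic (μ : Measure ℕ) [IsProbabilityMeasure μ] (ρ : ℝ≥0) (k : ℕ) :
    ((μ.prod (poissonMeasure ρ)).map queueStep).real (Set.Iic k) =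
      cauchyProd (poissonMass ρ) (fun j => μ.real (Set.Iic (j + 1))) k := by
  rw [map_measureReal_apply .of_discrete measurableSet_Iic, queueStep_preimage_Iic,
    measureReal_biUnion_finset ?_ fun _ _ => .of_discrete]
  · refine Finset.sum_congr rfl fun x _ => ?_
    rw [measureReal_prod_prod, poissonMeasure_real_singleton, mul_comm, poissonMass]
  · intro x hx y hy hxy
    rw [Function.onFun, Set.disjoint_left]
    rintro ⟨n, m⟩ ⟨-, h1⟩ ⟨-, h2⟩
    simp only [Set.mem_singleton_iff] at h1 h2
    simp only [Finset.mem_coe, Finset.HasAntidiagonal.mem_antidiagonal] at hx hy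
    exact hxy (Prod.ext (by omega) (by omega))

lemma measureTail_map_queueStep (μ : Measure ℕ) [IsProbabilityMeasure μ] (ρ : ℝ≥0)
    (hρ : (ρ : ℝ) = measureTail μ 0) :
    measureTail ((μ.prod (poissonMeasure ρ)).map queueStep) = tailStep (measureTail μ) := by
  have : IsProbabilityMeasure ((μ.prod (poissonMeasure ρ)).map queueStep) :=
    Measure.isProbabilityMeasure_map .of_discrete
  funext k
  have h := map_queueStep_real_Iic μ ρ k
  simp_rw [measureReal_Iic] at h
  rw [cauchyProd_sub (poissonMass ρ) (fun _ => 1)] at h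
  rw [tailStep, poissonTail, ← hρ]
  linarith

lemma bind_md1Kernel (μ : Measure ℕ) [IsProbabilityMeasure μ] (ρ : ℝ≥0) :
    μ.bind (md1Kernel ρ) = (μ.prod (poissonMeasure ρ)).map queueStep := by
  ext s hs
  rw [Measure.bind_apply hs (Kernel.aemeasurable _), Measure.map_apply .of_discrete hs,
    Measure.prod_apply .of_discrete]
  refine lintegral_congr fun n => ?_
  exact Measure.map_apply .of_discrete hs

lemma Nat.measure_ext_of_tail {μ ν : Measure ℕ} [IsProbabilityMeasure μ] [IsProbabilityMeasure ν]
    (h : measureTail μ = measureTail ν) : μ = ν := by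
  refine Measure.ext_of_Iic μ ν fun k => ?_
  rw [← measureReal_eq_measureReal_iff, measureReal_Iic, measureReal_Iic, h]

lemma measureTail_antitone (μ : Measure ℕ) [IsProbabilityMeasure μ] : Antitone (measureTail μ) :=
  fun _ _ hij => measureReal_mono (Set.Ioi_subset_Ioi hij)

lemma hasSum_measureReal_mul {μ : Measure ℕ} [IsFiniteMeasure μ] {f : ℕ → ℝ}
    (hf : Integrable f μ) : HasSum (fun n => μ.real {n} * f n) (∫ n, f n ∂μ) := by
  have hf' := hf
  rw [← Measure.sum_smul_dirac μ] at hf'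
  have h := hasSum_integral_measure hf'
  rw [Measure.sum_smul_dirac] at h
  refine h.congr_fun fun n => ?_
  rw [integral_smul_measure, integral_dirac, measureReal_def, smul_eq_mul]

lemma measureReal_Ioi_hasSum (μ : Measure ℕ) [IsProbabilityMeasure μ] (k : ℕ) :
    HasSum (fun n => μ.real {n + (k + 1)}) (measureTail μ k) := by
  have h := hasSum_measureReal_mul (integrable_const (1 : ℝ) (μ := μ))
  simp only [mul_one, integral_const, probReal_univ, smul_eq_mul] at h
  have h1 := (hasSum_nat_add_iff' (k + 1)).2 h
  rw [sum_measureReal_singleton] at h1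
  have h2 := measureReal_Iic μ k
  rw [show ((Finset.range (k + 1) : Finset ℕ) : Set ℕ) = Set.Iic k by ext; simp] at h1
  rwa [h2, sub_sub_cancel] at h1

lemma tendsto_measureTail (μ : Measure ℕ) [IsProbabilityMeasure μ] :
    Tendsto (measureTail μ) atTop (𝓝 0) := by
  have h := hasSum_measureReal_mul (integrable_const (1 : ℝ) (μ := μ))
  simp only [mul_one, integral_const, probReal_univ, smul_eq_mul] at h
  refine ((tendsto_sum_nat_add fun n => μ.real {n}).comp (tendsto_add_atTop_nat 1)).congr
    fun k => ?_
  exact (measureReal_Ioi_hasSum μ k).tsum_eq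

lemma isTailOfMean_measureTail {μ : Measure ℕ} [IsProbabilityMeasure μ]
    (hμ : Integrable (fun n : ℕ => (n : ℝ)) μ) :
    IsTailOfMean (∫ n, (n : ℝ) ∂μ) (measureTail μ) := by
  refine ⟨measureTail_antitone μ, fun _ => measureReal_nonneg, ?_⟩
  refine hasSum_rows_of_hasSum_antidiagonal (f := fun x => μ.real {x.2 + (x.1 + 1)})
    (fun _ => measureReal_nonneg) (measureReal_Ioi_hasSum μ) ?_
  have h := (hasSum_nat_add_iff' 1).2 (hasSum_measureReal_mul hμ)
  simp only [Finset.sum_range_one, Nat.cast_zero, mul_zero, sub_zero] at h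
  refine h.congr_fun fun m => ?_
  rw [Finset.sum_congr rfl (g := fun _ => μ.real {m + 1}) fun x hx => by
      rw [← Finset.HasAntidiagonal.mem_antidiagonal.1 hx]; congr 2; ring]
  simp [mul_comm]

/-- A nonincreasing sequence with values in `[0, 1]` that tends to `0` is a tail function. -/
lemma exists_measureTail_eq {x : ℕ → ℝ} (hx : Antitone x) (h1 : x 0 ≤ 1)
    (h0 : Tendsto x atTop (𝓝 0)) :
    ∃ μ : Measure ℕ, IsProbabilityMeasure μ ∧ measureTail μ = x := by
  obtain ⟨w, hw⟩ : ∃ w : ℕ → ℝ, w = fun n => Nat.casesOn n (1 - x 0) fun m => x m - x (m + 1) :=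
    ⟨_, rfl⟩
  have hwz : w 0 = 1 - x 0 := by subst hw; rfl
  have hws : ∀ m, w (m + 1) = x m - x (m + 1) := fun m => by subst hw; rfl
  have hw0 : ∀ n, 0 ≤ w n
    | 0 => by rw [hwz]; linarith
    | m + 1 => by rw [hws]; linarith [hx (Nat.le_succ m)]
  have hsum : ∀ k, ∑ i ∈ Finset.range (k + 1), w i = 1 - x k := fun k => by
    induction k with
    | zero => simp [hwz]
    | succ k ih => rw [Finset.sum_range_succ, ih, hws]; ring
  have hw1 : HasSum w 1 := by
    rw [hasSum_iff_tendsto_nat_of_nonneg hw0, ← tendsto_add_atTop_iff_nat 1]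
    simp_rw [hsum]
    simpa using h0.const_sub 1
  have hprob : IsProbabilityMeasure
      (Measure.sum fun i : ℕ => ENNReal.ofReal (w i) • Measure.dirac i) :=
    HasSum.isProbabilityMeasure_sum_dirac hw0 hw1
  refine ⟨_, hprob, funext fun k => ?_⟩
  have h := measureReal_Iic (Measure.sum fun i : ℕ => ENNReal.ofReal (w i) • .dirac i) k
  rw [show Set.Iic k = ((Finset.range (k + 1) : Finset ℕ) : Set ℕ) by ext; simp,
    ← sum_measureReal_singleton] at h
  simp_rw [measureReal_def, Measure.sum_smul_dirac_singleton, ENNReal.toReal_ofReal (hw0 _)] at h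
  rw [hsum] at h
  linarith

/-- Weak convergence on `ℕ` follows from the convergence of the tail functions. -/
lemma tendsto_probabilityMeasure_of_tail {μ : ℕ → ProbabilityMeasure ℕ} {ν : ProbabilityMeasure ℕ}
    (h : Tendsto (fun t => measureTail (μ t : Measure ℕ)) atTop (𝓝 (measureTail (ν : Measure ℕ)))) :
    Tendsto μ atTop (𝓝 ν) := by
  have hsing : ∀ (m : Measure ℕ) [IsProbabilityMeasure m] (n : ℕ), m.real {n + 1} =
      measureTail m n - measureTail m (n + 1) := fun m _ n => by
    rw [measureTail, measureTail, ← measureReal_sdiff (Set.Ioi_subset_Ioi (Nat.le_succ n))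
      measurableSet_Ioi]
    congr 1
    ext i
    simp only [Set.mem_singleton_iff, Set.mem_sdiff, Set.mem_Ioi]
    omega
  have hsing0 : ∀ (m : Measure ℕ) [IsProbabilityMeasure m], m.real {0} = 1 - measureTail m 0 :=
    fun m _ => by
      rw [← measureReal_Iic]
      congr 1
      ext i
      simp
  rw [tendsto_pi_nhds] at h
  refine IsPiSystem.tendsto_probabilityMeasure_of_tendsto_of_mem
    (S := Set.range fun n : ℕ => ({n} : Set ℕ)) ?_ (fun _ _ => .of_discrete) ?_ ?_
  · rintro _ ⟨i, rfl⟩ _ ⟨j, rfl⟩ ⟨k, hk1, hk2⟩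
    exact ⟨i, by simp_all⟩
  · exact fun u _ x hx => ⟨_, ⟨x, rfl⟩, by simp, by simpa using hx⟩
  · rintro _ ⟨n, rfl⟩
    rw [← NNReal.tendsto_coe]
    simp_rw [← ProbabilityMeasure.measureReal_eq_coe_coeFn]
    obtain _ | n := n
    · simp_rw [hsing0]
      exact (h 0).const_sub 1
    · simp_rw [hsing]
      exact (h n).sub (h (n + 1))

/-! ### Uniqueness of the invariant law. -/

/-- The balance equations of the M/D/1 queue determine all values from the first one. -/
lemma eq_zero_of_balance {ρ : ℝ} {c : ℕ → ℝ} (h0 : c 0 = 0)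
    (hc : ∀ k, c k = cauchyProd (poissonMass ρ) (fun j => c (j + 1)) k) (k : ℕ) : c k = 0 := by
  induction k using Nat.strong_induction_on with
  | _ k ih =>
    obtain _ | k := k
    · exact h0
    · have h := hc k
      -- Only the term with zero arrivals involves `c (k + 1)`, and its coefficient is positive.
      rw [ih k (Nat.lt_succ_self k), cauchyProd, Finset.sum_eq_single (0, k)] at h
      · exact (mul_eq_zero.1 h.symm).resolve_left (poissonMass_zero_pos ρ).ne'
      · intro x hx hne
        have hx' := Finset.HasAntidiagonal.mem_antidiagonal.1 hx
        have : x.2 ≠ k := fun hk => hne (Prod.ext (by simp only; omega) hk)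
        rw [ih (x.2 + 1) (by omega), mul_zero]
      · simp

/-- The M/D/1 queue has at most one invariant probability measure. -/
lemma md1Kernel_invariant_unique {ρ : ℝ≥0} {μ ν : Measure ℕ} [IsProbabilityMeasure μ]
    [IsProbabilityMeasure ν] (hμ : (md1Kernel ρ).Invariant μ) (hν : (md1Kernel ρ).Invariant ν) :
    μ = ν := by
  have hbal : ∀ (m : Measure ℕ) [IsProbabilityMeasure m], (md1Kernel ρ).Invariant m → ∀ k,
      m.real (Set.Iic k) = cauchyProd (poissonMass ρ) (fun j => m.real (Set.Iic (j + 1))) k :=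
    fun m _ hm k => by
      conv_lhs => rw [← hm.def, bind_md1Kernel]
      exact map_queueStep_real_Iic m ρ k
  have hlim : ∀ (m : Measure ℕ) [IsProbabilityMeasure m],
      Tendsto (fun k => m.real (Set.Iic k)) atTop (𝓝 1) := fun m _ => by
    simp_rw [measureReal_Iic]
    simpa using (tendsto_measureTail m).const_sub 1
  -- This combination of the two distribution functions solves the linear balance equations and
  -- vanishes at 0; letting `k` tend to infinity then equates the masses at 0.
  have hcross := eq_zero_of_balance (ρ := ρ)
    (c := fun k => μ.real (Set.Iic 0) * ν.real (Set.Iic k) - ν.real (Set.Iic 0) * μ.real (Set.Iic k))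
    (by ring) fun k => by
      rw [hbal μ hμ k, hbal ν hν k, cauchyProd_sub]
      simp only [cauchyProd, Finset.mul_sum]
      congr 1 <;> exact Finset.sum_congr rfl fun x _ => by ring
  have heq : μ.real (Set.Iic 0) = ν.real (Set.Iic 0) := by
    have h := ((hlim ν).const_mul (μ.real (Set.Iic 0))).sub ((hlim μ).const_mul (ν.real (Set.Iic 0)))
    simp_rw [hcross, mul_one] at h
    exact sub_eq_zero.1 (tendsto_nhds_unique h tendsto_const_nhds)
  have hne : ν.real (Set.Iic 0) ≠ 0 := fun h => by
    have h1 := hlim ν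
    simp_rw [eq_zero_of_balance h (hbal ν hν)] at h1
    exact zero_ne_one (tendsto_nhds_unique tendsto_const_nhds h1)
  refine Nat.measure_ext_of_tail (funext fun k => ?_)
  have h := hcross k
  rw [heq, ← mul_sub] at h
  have h' := (mul_eq_zero.1 h).resolve_left hne
  rw [measureReal_Iic, measureReal_Iic] at h'
  linarith

/-! ### The nonlinear process and its limit. -/

section NonlinearProcess

variable {Ω : Type*} [MeasurableSpace Ω] {P : Measure Ω} {η N : ℕ → Ω → ℕ}

lemma IsNonlinearProcess.measurable (hη : IsNonlinearProcess P η N) (t : ℕ) :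
    Measurable (η t) := by
  induction t with
  | zero => exact hη.measurable_init
  | succ t ih =>
    have h : η (t + 1) = fun ω => queueStep (η t ω, N (t + 1) ω) := funext (hη.step t)
    rw [h]
    exact (Measurable.of_discrete (f := queueStep)).comp (ih.prodMk (hη.measurable_noise t))

lemma IsNonlinearProcess.map_succ [IsProbabilityMeasure P]
    (hη : IsNonlinearProcess P η N) (t : ℕ) :
    P.map (η (t + 1)) = ((P.map (η t)).prod
      (poissonMeasure (P {ω | 0 < η t ω}).toNNReal)).map queueStep := by
  have h : η (t + 1) = queueStep ∘ fun ω => (η t ω, N (t + 1) ω) := funext (hη.step t)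
  have hind : IndepFun (η t) (N (t + 1)) P :=
    (hη.indep t).comp (φ := fun s : Fin (t + 1) → ℕ => s (Fin.last t)) (ψ := id)
      (measurable_pi_apply _) measurable_id
  rw [h, ← Measure.map_map .of_discrete ((hη.measurable t).prodMk (hη.measurable_noise t)),
    (indepFun_iff_map_prod_eq_prod_map_map (hη.measurable t).aemeasurable
      (hη.measurable_noise t).aemeasurable).1 hind, hη.law_noise]

lemma IsNonlinearProcess.measureTail_succ [IsProbabilityMeasure P]
    (hη : IsNonlinearProcess P η N) (t : ℕ) :
    measureTail (P.map (η (t + 1))) = tailStep (measureTail (P.map (η t))) := by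
  have := Measure.isProbabilityMeasure_map (μ := P) (hη.measurable t).aemeasurable
  rw [hη.map_succ t]
  refine measureTail_map_queueStep _ _ ?_
  rw [measureTail, map_measureReal_apply (hη.measurable t) measurableSet_Ioi]
  rfl

end NonlinearProcess

/-- Long-time behaviour of the nonlinear process. -/
theorem mainTheorem2 {Ω : Type*} [MeasurableSpace Ω] (P : Measure Ω) [IsProbabilityMeasure P]
    (η N : ℕ → Ω → ℕ) (hη : IsNonlinearProcess P η N)
    (r : ℝ≥0) (hr : r < 1) (hmean : ∫ ω, (η 0 ω : ℝ) ∂P = r)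
    (hexp : ∃ l : ℝ, 0 < l ∧ Integrable (fun ω => Real.exp (l * (η 0 ω : ℝ))) P) :
    ∃ π : ProbabilityMeasure ℕ, IsMD1InvariantLaw (arrivalRate r) π ∧
      TendstoInDistribution η atTop (id : ℕ → ℕ) (fun _ => P) (π : Measure ℕ) := by
  obtain ⟨l, hl, hint⟩ := hexp
  have hr1 : (r : ℝ) < 1 := by exact_mod_cast hr
  have hr0 : (0 : ℝ) ≤ r := r.coe_nonneg
  have hprob : ∀ t, IsProbabilityMeasure (P.map (η t)) := fun t =>
    Measure.isProbabilityMeasure_map (hη.measurable t).aemeasurable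
  obtain ⟨F, hF⟩ : ∃ F, F = fun t => measureTail (P.map (η t)) := ⟨_, rfl⟩
  have hFt : ∀ t, measureTail (P.map (η t)) = F t := fun t => by rw [hF]
  have hstep : ∀ t, F (t + 1) = tailStep (F t) := fun t => by
    rw [← hFt, ← hFt, hη.measureTail_succ]
  -- the mean is preserved
  have hmap : Measurable fun ω => (η 0 ω : ℝ) := Measurable.of_discrete.comp (hη.measurable 0)
  have hint0 : Integrable (fun ω => (η 0 ω : ℝ)) P := by
    refine (hint.const_mul l⁻¹).mono' hmap.aestronglyMeasurable (.of_forall fun ω => ?_)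
    rw [Real.norm_of_nonneg (by positivity), inv_mul_eq_div, le_div_iff₀ hl]
    linarith [Real.add_one_le_exp (l * (η 0 ω : ℝ))]
  have hFmean : ∀ t, IsTailOfMean r (F t) := fun t => by
    induction t with
    | zero =>
      have h := isTailOfMean_measureTail (μ := P.map (η 0))
        ((integrable_map_measure .of_discrete (hη.measurable 0).aemeasurable).2 hint0)
      rwa [integral_map (hη.measurable 0).aemeasurable .of_discrete, hmean, hFt] at h
    | succ t ih =>
      refine ⟨hFt (t + 1) ▸ measureTail_antitone _, hFt (t + 1) ▸ fun _ => measureReal_nonneg, ?_⟩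
      rw [hstep]
      exact hasSum_tailStep ih
  -- the tails decay geometrically, uniformly in time
  obtain ⟨s, hs1, hsl, hsr⟩ : ∃ s : ℝ, 1 < s ∧ s ≤ Real.exp l ∧ r * s ≤ 1 := by
    -- `2 / (1 + r)` exceeds 1 because `r < 1`, and `r * (2 / (1 + r)) ≤ 1`.
    refine ⟨min (Real.exp l) (2 / (1 + r)), lt_min (by simpa) ?_, min_le_left _ _, ?_⟩
    · rw [lt_div_iff₀ (by positivity)]; linarith
    · refine (mul_le_mul_of_nonneg_left (min_le_right _ _) hr0).trans ?_
      rw [← mul_div_assoc, div_le_one (by positivity)]; linarith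
  have hs0 : 0 < s := by linarith
  have hexps : ∀ t, Real.exp (F t 0 * (s - 1)) ≤ s := fun t => by
    rw [← Real.le_log_iff_exp_le hs0]
    refine le_trans ?_ (Real.one_sub_inv_le_log_of_pos hs0)
    calc F t 0 * (s - 1) ≤ r * (s - 1) :=
          mul_le_mul_of_nonneg_right ((hFmean t).le 0) (by linarith)
      _ = r * s * (1 - s⁻¹) := by field_simp
      _ ≤ 1 * (1 - s⁻¹) :=
          mul_le_mul_of_nonneg_right hsr (sub_nonneg.2 (inv_le_one_of_one_le₀ hs1.le))
      _ = 1 - s⁻¹ := one_mul _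
  obtain ⟨C, hbound⟩ : ∃ C : ℝ, ∀ t k, F t k ≤ C * s⁻¹ ^ k := by
    -- The integral serves Markov's inequality at time 0; the 1 serves the induction step.
    refine ⟨max 1 (∫ ω, Real.exp (l * (η 0 ω : ℝ)) ∂P), fun t => ?_⟩
    induction t with
    | zero =>
      intro k
      have hM := mul_meas_ge_le_integral_of_nonneg (.of_forall fun _ => (Real.exp_pos _).le) hint
        (s ^ k)
      rw [inv_pow, ← div_eq_mul_inv, le_div_iff₀ (by positivity), mul_comm]
      refine le_trans ?_ (hM.trans (le_max_right _ _))
      refine mul_le_mul_of_nonneg_left ?_ (by positivity)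
      rw [← hFt, measureTail, map_measureReal_apply (hη.measurable 0) measurableSet_Ioi]
      refine measureReal_mono fun ω hω => ?_
      simp only [Set.mem_preimage, Set.mem_Ioi, Set.mem_ofPred_eq] at hω ⊢
      calc s ^ k ≤ Real.exp l ^ k := by gcongr
        _ ≤ Real.exp l ^ (η 0 ω) := pow_le_pow_right₀ (Real.one_le_exp hl.le) hω.le
        _ = Real.exp (l * (η 0 ω : ℝ)) := by rw [← Real.exp_nat_mul, mul_comm]
    | succ t ih =>
      rw [hstep]
      exact tailStep_le_geometric (le_max_left _ _) hs1.le ((hFmean t).nonneg 0) ih (hexps t)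
  have hq1 : s⁻¹ < 1 := inv_lt_one_of_one_lt₀ hs1
  obtain ⟨x, hxT, hxb, hfix, hlim⟩ := exists_tailStep_limit hr1 (inv_nonneg.2 hs0.le) hq1
    hFmean hbound hstep
  have hrate : ((arrivalRate r : ℝ≥0) : ℝ) = x 0 := by
    refine (apply_zero_of_tailStep_eq hxT ?_ hfix).symm
    refine Summable.of_nonneg_of_le (fun k => mul_nonneg (by positivity) (hxT.nonneg k))
      (fun k => mul_le_mul_of_nonneg_left (hxb k) (by positivity)) ?_
    have h := (summable_pow_mul_geometric_of_norm_lt_one 1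
      (by rwa [Real.norm_of_nonneg (inv_nonneg.2 hs0.le)] : ‖s⁻¹‖ < 1)).mul_left C
    exact h.congr fun k => by ring
  obtain ⟨π, hπ, hπx⟩ := exists_measureTail_eq hxT.antitone ((hxT.le 0).trans hr1.le)
    hxT.hasSum.summable.tendsto_atTop_zero
  have hinv : (md1Kernel (arrivalRate r)).Invariant π := by
    have : IsProbabilityMeasure ((π.prod (poissonMeasure (arrivalRate r))).map queueStep) :=
      Measure.isProbabilityMeasure_map .of_discrete
    rw [Kernel.Invariant, bind_md1Kernel]
    refine Nat.measure_ext_of_tail ?_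
    rw [measureTail_map_queueStep π _ (by rw [hrate, hπx]), hπx, hfix]
  obtain ⟨ν, hν⟩ : ∃ ν : ProbabilityMeasure ℕ, (ν : Measure ℕ) = π := ⟨⟨π, hπ⟩, rfl⟩
  rw [← hν] at hinv hπx
  refine ⟨ν, ⟨hinv, fun π' hπ' => ?_⟩,
    ⟨fun t => (hη.measurable t).aemeasurable, aemeasurable_id, ?_⟩⟩
  · have h : (π' : Measure ℕ) = ν := md1Kernel_invariant_unique hπ' hinv
    exact Subtype.ext h
  refine tendsto_probabilityMeasure_of_tail ?_
  simp only [ProbabilityMeasure.coe_mk, Measure.map_id, hFt, hπx]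
  exact hlim
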